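/- **Theorem (Revolving Door Criterion).** Let $\mathcal F$ be the ring of real-rational functions $P(\mathbf z)$ with no poles on the unit circle $|\mathbf z|=1$. Such a $P$ has a unique expansion $P(\mathbf z)=\sum_{k\in\mathbb Z}p_k\mathbf z^{-k}$ on $|\mathbf z|=1$; $P$ is causal if $p_k=0$ for $k<0$, and $x=P(\mathbf z)u$ means $x(t)=\sum_k p_{t-k}u(k)$ (in mean square). The power spectral density of a wide-sense stationary real vector process $y$ is $\Phi_y(\mathbf z)=\sum_{\tau}\mathbf E[y(\tau)y(0)^T]\,\mathbf z^{-\tau}$, $|\mathbf z|=1$. For processes $x,y$, the (non-causal) Wiener filter $W_{x|y}$ is the matrix $W$ over $\mathcal F$ for which $q=W(\mathbf z)y$ minimizes $\mathbf E[(x-q)^T(x-q)]$ among all $q=P(\mathbf z)y$ with $P$ a matrix over $\mathcal F$; when $y$ is a stack of vectors that includes $y_v$, $W_{x[y_v]|y}$ denotes the block of columns of $W_{x|y}$ acting on $y_v$. Let $y=(y_i,y_j,y_k,y_s)$ be a wide-sense stationary process with (vector-valued) components $y_i,y_j,y_k,y_s$ that is the output of a linear dynamic influence model $(Q(\mathbf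 z),e)$, that is, $y=Q(\mathbf z)y+e$, where $Q$ is a block matrix over $\mathcal F$ and $e=P(\mathbf z)u$ with $P$ a block-diagonal matrix of causal elements of $\mathcal F$ and $u$ a wide-sense stationary process with $\Phi_u=\mathcal I$. Suppose that the directed graph with the edges $i\to j$, $j\to k$, $k\to i$, $s\to i$, $s\to j$, $s\to k$ (and no others, in particular no self-loops) is a graphical representation of the model: the block $Q_{wv}$ is zero whenever $v\to w$ is not one of these edges (blocks $Q_{wv}$ of edges $v\to w$ may also be zero). Suppose finally that $\Phi_y(\mathbf z)$ exists (the defining series converges) and is positive definite for all $|\mathbf z|=1$. Then the Wiener filters $W_{y_j|(y_i,y_k,y_s)}$, $W_{y_k|(y_j,y_i,y_s)}$ and $W_{y_i|(y_k,y_j,y_s)}$ exist and are unique and, writing $$W_{ji}=W_{y_j[y_i]|(y_i,y_k,y_s)},\quad W_{jk}=W_{y_j[y_k]|(y_i,y_k,y_s)},\quad W_{kj}=W_{y_k[y_j]|(y_j,y_i,y_s)},$$ $$W_{ki}=W_{y_k[y_i]|(y_j,y_i,y_s)},\quad W_{ik}=W_{y_i[y_k]|(y_k,y_j,y_s)},\quad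 W_{ij}=W_{y_i[y_j]|(y_k,y_j,y_s)},$$ the transfer matrix $Q_{ji}$ satisfies the implicit relation $$Q_{ji}=\Bigl\{\mathcal I-W_{jk}W_{kj}-W_{jk}W_{ki}\bigl(\mathcal I-W_{ij}Q_{ji}-W_{ik}W_{ki}\bigr)^{-1}W_{ik}W_{kj}\Bigr\}^{-1}W_{ji},$$ where both of the inverses exist as matrices over $\mathcal F$. -/

import Mathlib

open MeasureTheory
open scoped ComplexOrder

noncomputable section

namespace LDIM

/-! ### Transfer functions -/

/-- The ring of transfer functions: real-rational functions without poles on the unit circle. -/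
def TransferFunction : Subring (RatFunc ℝ) where
  carrier := {f | ∀ z : ℂ, ‖z‖ = 1 → Polynomial.aeval z f.denom ≠ 0}
  mul_mem' := by
    intro f g hf hg z hz h0
    have h := Polynomial.aeval_eq_zero_of_dvd_aeval_eq_zero (RatFunc.denom_mul_dvd f g) h0
    rw [map_mul] at h
    exact (mul_ne_zero (hf z hz) (hg z hz)) h
  one_mem' := by
    intro z _
    simp
  add_mem' := by
    intro f g hf hg z hz h0
    have h := Polynomial.aeval_eq_zero_of_dvd_aeval_eq_zero (RatFunc.denom_add_dvd f g) h0
    rw [map_mul] at h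
    exact (mul_ne_zero (hf z hz) (hg z hz)) h
  zero_mem' := by
    intro z _
    simp
  neg_mem' := by
    intro f hf z hz h0
    have hd : (-f).denom ∣ f.denom := by
      rw [RatFunc.denom_dvd (RatFunc.denom_ne_zero f)]
      exact ⟨-f.num, by rw [map_neg, neg_div, RatFunc.num_div_denom]⟩
    exact hf z hz (Polynomial.aeval_eq_zero_of_dvd_aeval_eq_zero hd h0)

/-- The value of a transfer function at a complex number. -/
def evalAt (P : TransferFunction) (z : ℂ) : ℂ :=
  RatFunc.eval (algebraMap ℝ ℂ) z (P : RatFunc ℝ)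

/-- `p` is the impulse response of `P`: `P(z) = ∑ₖ pₖ z⁻ᵏ` for `|z| = 1`. -/
def IsImpulseResponse (P : TransferFunction) (p : ℤ → ℝ) : Prop :=
  ∀ z : ℂ, ‖z‖ = 1 → HasSum (fun k : ℤ => (p k : ℂ) * z ^ (-k)) (evalAt P z)

/-- Causal transfer functions: the impulse response vanishes at negative times. -/
def IsCausal (P : TransferFunction) : Prop :=
  ∃ p : ℤ → ℝ, IsImpulseResponse P p ∧ ∀ k < 0, p k = 0

/-! ### Second-order vector processes in discrete time -/

/-- A real vector process indexed by `ℤ`, with square integrable coordinates. -/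
abbrev VecProcess {Ω : Type*} [MeasurableSpace Ω] (μ : Measure Ω) (ι : Type*) :=
  ℤ → ι → Lp ℝ 2 μ

section Processes

variable {Ω : Type*} [MeasurableSpace Ω] {μ : Measure Ω} {ι κ : Type*}

/-- The correlation matrix `R(τ) = E[y(τ) y(0)ᵀ]`. -/
def correlation (y : VecProcess μ ι) (τ : ℤ) : Matrix ι ι ℝ :=
  Matrix.of fun a b => inner ℝ (y τ a) (y 0 b)

/-- Wide-sense stationarity: the mean and the correlations are invariant under time shifts. -/
structure IsWSS (y : VecProcess μ ι) : Prop where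
  mean_eq : ∀ t a, ∫ ω, y t a ω ∂μ = ∫ ω, y 0 a ω ∂μ
  inner_eq : ∀ t τ a b, inner ℝ (y (t + τ) a) (y t b) = correlation y τ a b

/-- `Φ` is the power spectral density of `y` on the unit circle: `Φ(z) = ∑_τ R(τ) z^{-τ}`. -/
def HasPSD (y : VecProcess μ ι) (Φ : ℂ → Matrix ι ι ℂ) : Prop :=
  ∀ z : ℂ, ‖z‖ = 1 → ∀ a b,
    HasSum (fun τ : ℤ => (correlation y τ a b : ℂ) * z ^ (-τ)) (Φ z a b)

/-- `x = P(z) u`: the process `x` is the convolution of `u` with the impulse response of `P`,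
`x(t) = ∑ₖ p(t - k) u(k)`, the series converging in mean square. -/
def IsFiltered [Fintype κ] (P : Matrix ι κ TransferFunction) (u : VecProcess μ κ)
    (x : VecProcess μ ι) : Prop :=
  ∃ p : ι → κ → ℤ → ℝ, (∀ a b, IsImpulseResponse (P a b) (p a b)) ∧
    ∀ t a, HasSum (fun k : ℤ => ∑ b, p a b (t - k) • u k b) (x t a)

/-- `W` is a (non-causal) Wiener filter estimating `x` from `y`: the process `W(z) y` minimizes
the mean square error `E[(x - q)ᵀ (x - q)]` among all `q = P(z) y` with `P` a matrix of transfer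
functions, that is, over the transfer function span of `y`. -/
def IsWienerFilter [Fintype ι] [Fintype κ] (x : VecProcess μ ι) (y : VecProcess μ κ)
    (W : Matrix ι κ TransferFunction) : Prop :=
  ∃ xhat : VecProcess μ ι, IsFiltered W y xhat ∧
    ∀ (P : Matrix ι κ TransferFunction) (q : VecProcess μ ι), IsFiltered P y q →
      ∀ t, ∑ a, ‖x t a - xhat t a‖ ^ 2 ≤ ∑ a, ‖x t a - q t a‖ ^ 2

end Processes

/-! ### Block structure: node `v` carries a vector process of dimension `d v` -/

section Blocks

variable {V : Type*}

/-- The scalar coordinates of the stacked vector of all nodes. -/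
abbrev Coord (d : V → ℕ) := Σ v : V, Fin (d v)

/-- The scalar coordinates of the stacked vector of the nodes in `S`. -/
abbrev SubCoord (d : V → ℕ) (S : Finset V) := Σ v : {v : V // v ∈ S}, Fin (d v)

variable {d : V → ℕ}

/-- The block of `Q` in block row `w` and block column `v`, mapping node `v` to node `w`. -/
def block (Q : Matrix (Coord d) (Coord d) TransferFunction) (w v : V) :
    Matrix (Fin (d w)) (Fin (d v)) TransferFunction :=
  Matrix.of fun a b => Q ⟨w, a⟩ ⟨v, b⟩

/-- The component, acting on node `v`, of a filter whose input is the vector of nodes in `S`. -/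
def component {ι : Type*} {S : Finset V} (W : Matrix ι (SubCoord d S) TransferFunction)
    (v : V) (hv : v ∈ S) : Matrix ι (Fin (d v)) TransferFunction :=
  Matrix.of fun a b => W a ⟨⟨v, hv⟩, b⟩

variable {Ω : Type*} [MeasurableSpace Ω] {μ : Measure Ω}

/-- The vector process at node `v`. -/
def nodeProcess (y : VecProcess μ (Coord d)) (v : V) : VecProcess μ (Fin (d v)) :=
  fun t a => y t ⟨v, a⟩

/-- The vector process obtained by stacking the nodes in `S`. -/
def subProcess (y : VecProcess μ (Coord d)) (S : Finset V) : VecProcess μ (SubCoord d S) :=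
  fun t a => y t ⟨a.1, a.2⟩

/-- `(Q, e)` is a linear dynamic influence model with output `y`: `y = Q(z) y + e`, where
`e = P(z) u` with `P` causal and block diagonal and `u` wide-sense stationary with `Φ_u = I`. -/
structure IsLDIM [Fintype V] [DecidableEq V] (Q : Matrix (Coord d) (Coord d) TransferFunction)
    (e y : VecProcess μ (Coord d)) : Prop where
  wss : IsWSS y
  input : ∃ (m : V → ℕ) (u : VecProcess μ (Coord m))
    (P : Matrix (Coord d) (Coord m) TransferFunction),
      IsWSS u ∧ HasPSD u (fun _ => 1) ∧
      (∀ a b, IsCausal (P a b)) ∧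
      (∀ (a : Coord d) (b : Coord m), a.1 ≠ b.1 → P a b = 0) ∧
      IsFiltered P u e
  dynamics : IsFiltered Q y (y - e)

/-- `G` is a graphical representation of `Q`: a missing edge `v → w` forces `Q_{wv} = 0`. -/
def IsGraphicalRepresentation (G : Digraph V)
    (Q : Matrix (Coord d) (Coord d) TransferFunction) : Prop :=
  ∀ v w, ¬ G.Adj v w → block Q w v = 0

end Blocks

/-! ### The four-node loop with a common external process -/

/-- The four nodes `y_i, y_j, y_k, y_s`. -/
inductive Node
  | i | j | k | s
  deriving DecidableEq

instance : Fintype Node :=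
  ⟨{.i, .j, .k, .s}, by intro v; cases v <;> decide⟩

/-- The loop `i → j → k → i` together with the edges `s → i`, `s → j`, `s → k`. -/
def loopGraph : Digraph Node where
  Adj v w := (v, w) ∈ ({(.i, .j), (.j, .k), (.k, .i), (.s, .i), (.s, .j), (.s, .k)} :
    Set (Node × Node))

end LDIM

end

/-!
A matrix `W` is a Wiener filter exactly when the error is orthogonal to the observations, that is,
when `Φ_xy = W Φ_yy` on the unit circle. If the inverse spectrum `K = Φ⁻¹` is rational, the
filter that estimates `y_v` from all the other nodes is read off the `v`-th block row of `K`: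
`K_vv W = -K_v•`. For an influence model without self-loops `K = (1 - Q)ᴴ S (1 - Q)`, where `S` is
the block diagonal inverse of the noise spectrum.

Suppose that `n` is the only child of `v`, and that neither `n` is a parent of `v` nor `p` a parent
of `n`. Then `K_vv = S_v + Q_nvᴴ S_n Q_nv`, `K_vn = -Q_nvᴴ S_n` and `K_vp = -S_v Q_vp`, whence
`(1 - W_vn Q_nv) Q_vp = W_vp` with an invertible first factor. The three nodes of the loop give
three such relations, and eliminating `Q_kj` and `Q_ik` from them leaves the implicit equation for
`Q_ji`.
-/

open scoped Matrix

noncomputable section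

namespace LDIM

/-! ### Transfer functions as functions on the unit circle -/

/-- Evaluation of transfer functions at a point of the unit circle. -/
def evalHom (z : Circle) : TransferFunction →+* ℂ where
  toFun f := evalAt f z
  map_one' := by simp [evalAt]
  map_zero' := by simp [evalAt]
  map_mul' f g :=
    RatFunc.eval_mul (algebraMap ℝ ℂ) z (f.2 z z.norm_coe) (g.2 z z.norm_coe)
  map_add' f g :=
    RatFunc.eval_add (algebraMap ℝ ℂ) z (f.2 z z.norm_coe) (g.2 z z.norm_coe)

theorem evalHom_eq_div (z : Circle) (f : TransferFunction) :
    evalHom z f = Polynomial.aeval (z : ℂ) (f : RatFunc ℝ).num /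
      Polynomial.aeval (z : ℂ) (f : RatFunc ℝ).denom := rfl

theorem aeval_denom_ne_zero (z : Circle) (f : TransferFunction) :
    Polynomial.aeval (z : ℂ) (f : RatFunc ℝ).denom ≠ 0 :=
  f.2 z z.norm_coe

theorem infinite_circle : Infinite Circle := by
  refine Set.infinite_univ_iff.1 (isPreconnected_univ.infinite_of_nontrivial ?_)
  refine Set.nontrivial_univ_iff.2 ⟨1, Circle.exp Real.pi, fun h => ?_⟩
  have := congrArg ((↑) : Circle → ℂ) h
  norm_num [Circle.coe_exp] at this

theorem eq_zero_of_aeval_circle {p : Polynomial ℝ}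
    (h : ∀ z : Circle, Polynomial.aeval (z : ℂ) p = 0) : p = 0 := by
  have := infinite_circle
  have hrange : (Set.range fun z : Circle => (z : ℂ)).Infinite :=
    @Set.infinite_range_of_injective Circle ℂ _ _ Circle.coe_injective
  rw [← Polynomial.map_eq_zero_iff (algebraMap ℝ ℂ).injective]
  refine Polynomial.eq_zero_of_infinite_isRoot _ (hrange.mono ?_)
  rintro _ ⟨z, rfl⟩
  simpa [Polynomial.IsRoot, Polynomial.eval_map_algebraMap] using h z

theorem evalHom_ext {f g : TransferFunction} (h : ∀ z, evalHom z f = evalHom z g) : f = g := by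
  rw [← sub_eq_zero]
  refine Subtype.ext (RatFunc.num_eq_zero_iff.1 (eq_zero_of_aeval_circle fun z => ?_))
  have hz : evalHom z (f - g) = 0 := by rw [map_sub, h z, sub_self]
  rw [evalHom_eq_div, div_eq_zero_iff] at hz
  exact hz.resolve_right (aeval_denom_ne_zero z (f - g))

/-- The transfer function `p / q`, for polynomials `p` and `q` with `q` free of zeros on the unit
circle. -/
def ofDiv (p q : Polynomial ℝ) (hq : ∀ z : Circle, Polynomial.aeval (z : ℂ) q ≠ 0) :
    TransferFunction :=
  ⟨algebraMap _ (RatFunc ℝ) p / algebraMap _ (RatFunc ℝ) q, fun z hz hd => by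
    have hq0 : q ≠ 0 := by rintro rfl; exact hq 1 (map_zero _)
    exact hq ⟨z, mem_sphere_zero_iff_norm.2 hz⟩ (Polynomial.aeval_eq_zero_of_dvd_aeval_eq_zero
      ((RatFunc.denom_dvd hq0).2 ⟨p, rfl⟩) hd)⟩

theorem evalHom_ofDiv (p q : Polynomial ℝ) (hq : ∀ z : Circle, Polynomial.aeval (z : ℂ) q ≠ 0)
    (z : Circle) :
    evalHom z (ofDiv p q hq) = Polynomial.aeval (z : ℂ) p / Polynomial.aeval (z : ℂ) q := by
  have hq0 : q ≠ 0 := by rintro rfl; exact hq 1 (map_zero _)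
  rw [evalHom_eq_div, div_eq_div_iff (aeval_denom_ne_zero z _) (hq z), ← map_mul, ← map_mul]
  exact congrArg _ ((RatFunc.num_mul_eq_mul_denom_iff hq0).2 rfl)

theorem isUnit_of_evalHom_ne_zero {f : TransferFunction} (h : ∀ z, evalHom z f ≠ 0) :
    IsUnit f := by
  have hnum (z : Circle) : Polynomial.aeval (z : ℂ) (f : RatFunc ℝ).num ≠ 0 := fun h0 =>
    h z (by rw [evalHom_eq_div, h0, zero_div])
  refine IsUnit.of_mul_eq_one (ofDiv (f : RatFunc ℝ).denom (f : RatFunc ℝ).num hnum)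
    (evalHom_ext fun z => ?_)
  rw [map_mul, map_one, evalHom_ofDiv, evalHom_eq_div, div_mul_div_comm, mul_comm,
    div_self (mul_ne_zero (aeval_denom_ne_zero z f) (hnum z))]

theorem star_coe_circle (z : Circle) : star (z : ℂ) = (z : ℂ)⁻¹ := by
  rw [← Circle.coe_inv, Circle.coe_inv_eq_conj, starRingEnd_apply]

theorem aeval_reverse_circle (p : Polynomial ℝ) (z : Circle) :
    Polynomial.aeval (z : ℂ) p.reverse =
      (z : ℂ) ^ p.natDegree * star (Polynomial.aeval (z : ℂ) p) := by
  let _ : Invertible (star (z : ℂ)) :=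
    invertibleOfNonzero (star_coe_circle z ▸ inv_ne_zero (Circle.coe_ne_zero z))
  have hinv : ⅟(star (z : ℂ)) = z := by rw [invOf_eq_inv, star_coe_circle, inv_inv]
  have hrev := Polynomial.eval₂_reverse_mul_pow (algebraMap ℝ ℂ) (star (z : ℂ)) p
  rw [hinv] at hrev
  have hstar : star (Polynomial.aeval (z : ℂ) p) = Polynomial.aeval (star (z : ℂ)) p :=
    (Polynomial.aeval_conj p (z : ℂ)).symm
  rw [hstar, Polynomial.aeval_def, Polynomial.aeval_def, ← hrev, mul_left_comm, ← mul_pow,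
    star_coe_circle, mul_inv_cancel₀ (Circle.coe_ne_zero z), one_pow, mul_one]

/-- Para-conjugation `f(z) ↦ f(1/z)`, which is complex conjugation on the unit circle. -/
instance : Star TransferFunction where
  star f := ofDiv
    ((f : RatFunc ℝ).num.reverse * Polynomial.X ^ (f : RatFunc ℝ).denom.natDegree)
    ((f : RatFunc ℝ).denom.reverse * Polynomial.X ^ (f : RatFunc ℝ).num.natDegree)
    fun z => by
      rw [map_mul, aeval_reverse_circle, map_pow, Polynomial.aeval_X]
      exact mul_ne_zero (mul_ne_zero (pow_ne_zero _ z.coe_ne_zero)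
        (star_ne_zero.2 (aeval_denom_ne_zero z f))) (pow_ne_zero _ z.coe_ne_zero)

theorem evalHom_star (z : Circle) (f : TransferFunction) :
    evalHom z (star f) = star (evalHom z f) := by
  have hz := z.coe_ne_zero
  have hden : star (Polynomial.aeval (z : ℂ) (f : RatFunc ℝ).denom) ≠ 0 :=
    star_ne_zero.2 (aeval_denom_ne_zero z f)
  refine (evalHom_ofDiv _ _ _ z).trans ?_
  rw [evalHom_eq_div, star_div₀, map_mul, map_mul, aeval_reverse_circle, aeval_reverse_circle,
    map_pow, map_pow, Polynomial.aeval_X]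
  field_simp

instance : StarRing TransferFunction where
  star_involutive f := evalHom_ext fun z => by simp only [evalHom_star, star_star]
  star_mul f g := evalHom_ext fun z => by simp only [map_mul, evalHom_star, star_mul]
  star_add f g := evalHom_ext fun z => by simp only [map_add, evalHom_star, star_add]

section Matrices

variable {ι κ : Type*}

theorem map_evalHom_injective {P R : Matrix ι κ TransferFunction}
    (h : ∀ z, P.map (evalHom z) = R.map (evalHom z)) : P = R :=
  Matrix.ext fun a b => evalHom_ext fun z => congrFun (congrFun (h z) a) b

theorem map_evalHom_conjTranspose (z : Circle) (P : Matrix ι κ TransferFunction) :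
    Pᴴ.map (evalHom z) = (P.map (evalHom z))ᴴ :=
  Matrix.conjTranspose_map _ (evalHom_star z)

theorem isUnit_of_isUnit_map_evalHom [Fintype ι] [DecidableEq ι]
    {P : Matrix ι ι TransferFunction} (h : ∀ z, IsUnit (P.map (evalHom z))) : IsUnit P := by
  rw [Matrix.isUnit_iff_isUnit_det]
  refine isUnit_of_evalHom_ne_zero fun z => ?_
  rw [RingHom.map_det]
  exact ((Matrix.isUnit_iff_isUnit_det _).1 (h z)).ne_zero

end Matrices

/-! ### Absolutely convergent Laurent series on the unit circle -/

/-- `g` is the sum of the Laurent series `∑ₖ cₖ z⁻ᵏ` on the unit circle. Taking `z = 1` shows that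
the coefficients are then absolutely summable. -/
def HasLaurentSeries (c : ℤ → ℂ) (g : Circle → ℂ) : Prop :=
  ∀ z : Circle, HasSum (fun k => c k * (z : ℂ) ^ (-k)) (g z)

theorem isImpulseResponse_iff {P : TransferFunction} {p : ℤ → ℝ} :
    IsImpulseResponse P p ↔ HasLaurentSeries (fun k => (p k : ℂ)) (evalHom · P) :=
  ⟨fun h z => h z z.norm_coe, fun h z hz => h ⟨z, mem_sphere_zero_iff_norm.2 hz⟩⟩

theorem hasSum_conv {A R : Type*} [AddGroup A] [NormedRing R] [CompleteSpace R] {f g : A → R}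
    {a b : R} (hf : HasSum f a) (hf' : Summable fun n => ‖f n‖)
    (hg : HasSum g b) (hg' : Summable fun n => ‖g n‖) :
    HasSum (fun n => ∑' m, f (n - m) * g m) (a * b) := by
  have hprod : HasSum (fun x : A × A => f x.1 * g x.2) (a * b) :=
    hf.mul hg (summable_mul_of_summable_norm hf' hg')
  let shear : A × A ≃ A × A := (Equiv.prodComm A A).trans
    (((Equiv.refl A).prodShear Equiv.subRight).trans (Equiv.prodComm A A))
  have hshear : HasSum (fun x : A × A => f (x.1 - x.2) * g x.2) (a * b) :=
    shear.hasSum_iff.2 hprod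
  exact hshear.prod_fiberwise fun n => (hshear.summable.prod_factor n).hasSum

theorem inner_eq_of_hasSum_orthonormal {𝕜 E ι : Type*} [RCLike 𝕜] [NormedAddCommGroup E]
    [InnerProductSpace 𝕜 E] {v : ι → E} (hv : Orthonormal 𝕜 v) {c : ι → 𝕜} {x : E}
    (h : HasSum (fun k => c k • v k) x) (m : ι) : inner 𝕜 (v m) x = c m := by
  refine (h.mapL (innerSL 𝕜 (v m))).unique ?_
  have hsum := hasSum_single (f := fun k => innerSL 𝕜 (v m) (c k • v k)) m fun k hk => by
    simp [hv.inner_eq_zero hk.symm]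
  simpa [inner_smul_right, inner_self_eq_norm_sq_to_K, hv.norm_eq_one] using hsum

namespace HasLaurentSeries

variable {c c' : ℤ → ℂ} {g g' : Circle → ℂ}

theorem summable_norm (h : HasLaurentSeries c g) : Summable fun k => ‖c k‖ := by
  simpa using (h 1).summable.norm

theorem add (h : HasLaurentSeries c g) (h' : HasLaurentSeries c' g') :
    HasLaurentSeries (fun k => c k + c' k) (fun z => g z + g' z) := fun z => by
  simpa only [add_mul] using (h z).add (h' z)

theorem sub (h : HasLaurentSeries c g) (h' : HasLaurentSeries c' g') :
    HasLaurentSeries (fun k => c k - c' k) (fun z => g z - g' z) := fun z => by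
  simpa only [sub_mul] using (h z).sub (h' z)

theorem sum {α : Type*} {s : Finset α} {c : α → ℤ → ℂ} {g : α → Circle → ℂ}
    (h : ∀ a ∈ s, HasLaurentSeries (c a) (g a)) :
    HasLaurentSeries (fun k => ∑ a ∈ s, c a k) (fun z => ∑ a ∈ s, g a z) := fun z => by
  simpa only [Finset.sum_mul] using hasSum_sum fun a ha => h a ha z

theorem const_mul (h : HasLaurentSeries c g) (r : ℂ) :
    HasLaurentSeries (fun k => r * c k) (fun z => r * g z) := fun z => by
  simpa only [mul_assoc] using (h z).mul_left r

theorem monomial (n : ℤ) (r : ℂ) :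
    HasLaurentSeries (Pi.single n r) (fun z => r * (z : ℂ) ^ (-n)) := fun z => by
  have hsum := hasSum_single (f := fun k => (Pi.single n r : ℤ → ℂ) k * (z : ℂ) ^ (-k)) n
    fun k hk => by simp only [Pi.single_eq_of_ne hk, zero_mul]
  simpa only [Pi.single_eq_same] using hsum

theorem reflect (h : HasLaurentSeries c g) :
    HasLaurentSeries (fun k => c (-k)) (fun z => g z⁻¹) := fun z => by
  refine ((Equiv.neg ℤ).hasSum_iff.2 (h z⁻¹)).congr_fun fun k => ?_
  simp [Function.comp]

protected theorem star (h : HasLaurentSeries c g) :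
    HasLaurentSeries (fun k => star (c (-k))) (fun z => star (g z)) := fun z => by
  have hconj := ((Equiv.neg ℤ).hasSum_iff.2 (h z)).star
  simpa [Function.comp_def, star_coe_circle] using hconj

theorem conv_summable (h : HasLaurentSeries c g) (h' : HasLaurentSeries c' g') (n : ℤ) :
    Summable fun m => c (n - m) * c' m := by
  have hinj : Function.Injective fun m : ℤ => (n - m, m) := fun _ _ hab => (Prod.ext_iff.1 hab).2
  exact ((summable_mul_of_summable_norm h.summable_norm h'.summable_norm).comp_injective hinj :)

theorem conv (h : HasLaurentSeries c g) (h' : HasLaurentSeries c' g') :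
    HasLaurentSeries (fun n => ∑' m, c (n - m) * c' m) (fun z => g z * g' z) := fun z => by
  have hsum := hasSum_conv (h z) (h z).summable.norm (h' z) (h' z).summable.norm
  have hterm (n m : ℤ) : c (n - m) * (z : ℂ) ^ (-(n - m)) * (c' m * (z : ℂ) ^ (-m)) =
      c (n - m) * c' m * (z : ℂ) ^ (-n) := by
    rw [mul_mul_mul_comm, ← zpow_add₀ z.coe_ne_zero]
    congr 2
    ring
  simpa only [hterm, tsum_mul_right] using hsum

theorem eq_zero (h : HasLaurentSeries c 0) : c = 0 := by
  let term (k : ℤ) : C(AddCircle (1 : ℝ), ℂ) := c k • fourier (-k)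
  have hsummable : Summable term := by
    refine Summable.of_norm ?_
    simpa only [term, norm_smul, fourier_norm, mul_one] using h.summable_norm
  have hsum : HasSum term 0 := by
    convert hsummable.hasSum
    ext x
    refine (h (AddCircle.toCircle x)).unique ?_
    simpa [term, fourier_apply, AddCircle.toCircle_zsmul, AddCircle.toCircle_neg] using
      hsummable.hasSum.mapL (ContinuousMap.evalCLM ℂ x)
  have hLp := hsum.mapL (ContinuousMap.toLp 2 AddCircle.haarAddCircle ℂ)
  simp only [term, map_smul, map_zero] at hLp
  funext m
  have horth : Orthonormal ℂ fun k : ℤ => fourierLp (T := 1) 2 (-k) :=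
    orthonormal_fourier.comp _ neg_injective
  simpa using (inner_eq_of_hasSum_orthonormal horth hLp m).symm

theorem unique (h : HasLaurentSeries c g) (h' : HasLaurentSeries c' g) : c = c' :=
  sub_eq_zero.1 (eq_zero fun z => by
    simpa only [sub_self, Pi.sub_apply, Pi.zero_apply] using h.sub h' z)

end HasLaurentSeries

/-! ### Existence of impulse responses -/

theorem exists_hasLaurentSeries_inv_sub_of_norm_lt {a : ℂ} (ha : ‖a‖ < 1) :
    ∃ c, HasLaurentSeries c fun z => ((z : ℂ) - a)⁻¹ := by
  have hinj : Function.Injective fun n : ℕ => (n + 1 : ℤ) := fun m n hmn => by simpa using hmn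
  refine ⟨Function.extend (fun n : ℕ => (n + 1 : ℤ)) (fun n => a ^ n) 0, fun z => ?_⟩
  refine (hinj.hasSum_iff fun k hk => ?_).1 ?_
  · rw [Function.extend_apply' _ _ _ (by simpa using hk), Pi.zero_apply, zero_mul]
  · have hgeom := (hasSum_geometric_of_norm_lt_one (ξ := a / z)
      (by rwa [norm_div, Circle.norm_coe, div_one])).mul_left (z : ℂ)⁻¹
    rw [← mul_inv, mul_sub, mul_one, mul_div_cancel₀ _ z.coe_ne_zero] at hgeom
    refine hgeom.congr_fun fun n => ?_
    simp only [Function.comp, hinj.extend_apply]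
    rw [zpow_neg, zpow_add₀ z.coe_ne_zero, zpow_one, zpow_natCast, div_pow]
    field_simp

theorem exists_hasLaurentSeries_inv_sub {a : ℂ} (ha : ‖a‖ ≠ 1) :
    ∃ c, HasLaurentSeries c fun z => ((z : ℂ) - a)⁻¹ := by
  rcases ha.lt_or_gt with hlt | hgt
  · exact exists_hasLaurentSeries_inv_sub_of_norm_lt hlt
  have ha0 : a ≠ 0 := norm_pos_iff.1 (one_pos.trans hgt)
  obtain ⟨c, hc⟩ := exists_hasLaurentSeries_inv_sub_of_norm_lt (a := a⁻¹)
    (by rw [norm_inv]; exact inv_lt_one_of_one_lt₀ hgt)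
  have hinv (z : Circle) :
      ((z : ℂ) - a)⁻¹ = -a⁻¹ * (z : ℂ) ^ (-1 : ℤ) * ((z⁻¹ : Circle) - a⁻¹ : ℂ)⁻¹ := by
    have hz := z.coe_ne_zero
    rw [← neg_sub a, inv_neg, neg_mul, neg_mul, Circle.coe_inv, zpow_neg_one, ← mul_inv,
      ← mul_inv, mul_sub, mul_assoc, mul_inv_cancel₀ hz, mul_one, mul_right_comm,
      mul_inv_cancel₀ ha0, one_mul]
  simp only [hinv]
  exact ⟨_, (HasLaurentSeries.monomial 1 (-a⁻¹)).conv hc.reflect⟩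

theorem exists_hasLaurentSeries_inv_prod (s : Multiset ℂ) (hs : ∀ a ∈ s, ‖a‖ ≠ 1) :
    ∃ c, HasLaurentSeries c fun z => (s.map fun a => (z : ℂ) - a).prod⁻¹ := by
  induction s using Multiset.induction_on with
  | empty => exact ⟨_, by simpa using HasLaurentSeries.monomial 0 1⟩
  | cons a s ih =>
    obtain ⟨c, hc⟩ := exists_hasLaurentSeries_inv_sub (hs a (Multiset.mem_cons_self a s))
    obtain ⟨c', hc'⟩ := ih fun b hb => hs b (Multiset.mem_cons_of_mem hb)
    exact ⟨_, by simpa [mul_comm] using hc.conv hc'⟩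

theorem exists_hasLaurentSeries_aeval (p : Polynomial ℝ) :
    ∃ c, HasLaurentSeries c fun z => Polynomial.aeval (z : ℂ) p := by
  induction p using Polynomial.induction_on' with
  | add p q hp hq =>
    obtain ⟨c, hc⟩ := hp
    obtain ⟨c', hc'⟩ := hq
    exact ⟨_, by simpa only [map_add] using hc.add hc'⟩
  | monomial n r =>
    exact ⟨_, by simpa [Polynomial.aeval_monomial] using HasLaurentSeries.monomial (-n) r⟩

theorem exists_hasLaurentSeries_inv_aeval {q : Polynomial ℝ}
    (hq : ∀ z : Circle, Polynomial.aeval (z : ℂ) q ≠ 0) :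
    ∃ c, HasLaurentSeries c fun z => (Polynomial.aeval (z : ℂ) q)⁻¹ := by
  let r := q.map (algebraMap ℝ ℂ)
  have heval (z : ℂ) : Polynomial.aeval z q = r.eval z :=
    (Polynomial.eval_map_algebraMap q z).symm
  have hroots : ∀ a ∈ r.roots, ‖a‖ ≠ 1 := fun a ha hnorm =>
    hq ⟨a, mem_sphere_zero_iff_norm.2 hnorm⟩
      ((heval a).trans (Polynomial.isRoot_of_mem_roots ha))
  obtain ⟨c, hc⟩ := exists_hasLaurentSeries_inv_prod r.roots hroots
  have hfactor (z : ℂ) :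
      (Polynomial.aeval z q)⁻¹ = r.leadingCoeff⁻¹ * (r.roots.map fun a => z - a).prod⁻¹ := by
    rw [heval, ← mul_inv]
    conv_lhs => rw [(IsAlgClosed.splits r).eq_prod_roots]
    simp [Polynomial.eval_multiset_prod]
  simp only [hfactor]
  exact ⟨_, hc.const_mul _⟩

theorem evalHom_inv (z : Circle) (f : TransferFunction) : evalHom z⁻¹ f = star (evalHom z f) := by
  have haeval (p : Polynomial ℝ) :
      Polynomial.aeval ((z⁻¹ : Circle) : ℂ) p = star (Polynomial.aeval (z : ℂ) p) := by
    rw [Circle.coe_inv_eq_conj]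
    exact Polynomial.aeval_conj p (z : ℂ)
  rw [evalHom_eq_div, evalHom_eq_div, star_div₀, haeval, haeval]

theorem exists_isImpulseResponse (f : TransferFunction) : ∃ p, IsImpulseResponse f p := by
  obtain ⟨c, hc⟩ : ∃ c, HasLaurentSeries c (evalHom · f) := by
    obtain ⟨a, ha⟩ := exists_hasLaurentSeries_aeval (f : RatFunc ℝ).num
    obtain ⟨b, hb⟩ := exists_hasLaurentSeries_inv_aeval (aeval_denom_ne_zero · f)
    exact ⟨_, by simpa only [evalHom_eq_div, div_eq_mul_inv] using ha.conv hb⟩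
  -- `f` has real coefficients, hence so has its Laurent series
  have hreal : (fun k => star (c k)) = c := by
    refine HasLaurentSeries.unique ?_ hc
    simpa only [neg_neg, evalHom_inv, star_star] using hc.reflect.star
  refine ⟨fun k => (c k).re, isImpulseResponse_iff.2 ?_⟩
  simpa only [Complex.conj_eq_iff_re.1 (congrFun hreal _)] using hc

/-! ### Cross spectra -/

section Spectra

variable {Ω : Type*} [MeasurableSpace Ω] {μ : Measure Ω} {ι κ l : Type*}

/-- `x` and `y` are jointly stationary with cross spectral density `G`: the cross-correlation
`R(τ) = E[x(t + τ) y(t)ᵀ]` does not depend on `t`, and `G(z) = ∑_τ R(τ) z^{-τ}` on the unit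
circle. -/
def HasCrossSpectrum (x : VecProcess μ ι) (y : VecProcess μ κ) (G : Circle → Matrix ι κ ℂ) :
    Prop :=
  ∃ R : ι → κ → ℤ → ℝ, (∀ t τ a b, inner ℝ (x (t + τ) a) (y t b) = R a b τ) ∧
    ∀ a b, HasLaurentSeries (fun τ => (R a b τ : ℂ)) (fun z => G z a b)

theorem IsWSS.hasCrossSpectrum {y : VecProcess μ ι} {Φ : ℂ → Matrix ι ι ℂ} (h : IsWSS y)
    (hΦ : HasPSD y Φ) : HasCrossSpectrum y y fun z => Φ z :=
  ⟨fun a b τ => correlation y τ a b, h.inner_eq, fun a b z => hΦ z z.norm_coe a b⟩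

namespace HasCrossSpectrum

variable {x x' : VecProcess μ ι} {y : VecProcess μ κ} {G G' : Circle → Matrix ι κ ℂ}

theorem symm (h : HasCrossSpectrum x y G) : HasCrossSpectrum y x fun z => (G z)ᴴ := by
  obtain ⟨R, hR, hG⟩ := h
  refine ⟨fun b a τ => R a b (-τ), fun t τ b a => ?_, fun b a => ?_⟩
  · dsimp only
    rw [← hR (t + τ) (-τ), real_inner_comm, add_neg_cancel_right]
  · simpa [Matrix.conjTranspose_apply] using (hG a b).star

theorem sub_left (h : HasCrossSpectrum x y G) (h' : HasCrossSpectrum x' y G') :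
    HasCrossSpectrum (x - x') y fun z => G z - G' z := by
  obtain ⟨R, hR, hG⟩ := h
  obtain ⟨R', hR', hG'⟩ := h'
  refine ⟨fun a b τ => R a b τ - R' a b τ, fun t τ a b => ?_, fun a b => ?_⟩
  · rw [Pi.sub_apply, Pi.sub_apply, inner_sub_left, hR, hR']
  · simpa only [Matrix.sub_apply, Complex.ofReal_sub] using (hG a b).sub (hG' a b)

theorem submatrix {ι' κ' : Type*} (h : HasCrossSpectrum x y G) (f : ι' → ι) (g : κ' → κ) :
    HasCrossSpectrum (fun t a => x t (f a)) (fun t b => y t (g b))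
      fun z => (G z).submatrix f g := by
  obtain ⟨R, hR, hG⟩ := h
  exact ⟨fun a b => R (f a) (g b), fun t τ a b => hR t τ (f a) (g b), fun a b => hG (f a) (g b)⟩

theorem filter_left [Fintype ι] {P : Matrix l ι TransferFunction} {q : VecProcess μ l}
    (h : HasCrossSpectrum x y G) (hq : IsFiltered P x q) :
    HasCrossSpectrum q y fun z => P.map (evalHom z) * G z := by
  obtain ⟨R, hR, hG⟩ := h
  obtain ⟨p, hp, hq⟩ := hq
  replace hp := fun a b => isImpulseResponse_iff.1 (hp a b)
  refine ⟨fun a c τ => ∑ b, ∑' m, p a b (τ - m) * R b c m, fun t τ a c => ?_, fun a c => ?_⟩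
  · have hconv (b : ι) : Summable fun m => p a b (τ - m) * R b c m := by
      exact_mod_cast (hp a b).conv_summable (hG b c) τ
    have hinner := (Equiv.addLeft t).hasSum_iff.2 ((hq (t + τ) a).mapL (innerSL ℝ (y t c)))
    rw [real_inner_comm]
    refine (hinner.congr_fun fun m => ?_).unique (hasSum_sum fun b _ => (hconv b).hasSum)
    simp only [Function.comp_apply, Equiv.coe_addLeft, map_sum, map_smul, innerSL_apply_apply,
      smul_eq_mul, add_sub_add_left_eq_sub]
    exact Finset.sum_congr rfl fun b _ => by rw [real_inner_comm, hR]
  · simpa only [Matrix.mul_apply, Matrix.map_apply, Complex.ofReal_sum, Complex.ofReal_tsum,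
      Complex.ofReal_mul] using
      HasLaurentSeries.sum (s := Finset.univ) fun b _ => (hp a b).conv (hG b c)

theorem inner_eq_zero_iff (h : HasCrossSpectrum x y G) :
    (∀ t s a b, inner ℝ (x t a) (y s b) = 0) ↔ ∀ z, G z = 0 := by
  obtain ⟨R, hR, hG⟩ := h
  constructor
  · intro hinner z
    ext a b
    refine (hG a b z).unique ?_
    have hR0 (τ : ℤ) : R a b τ = 0 := by rw [← hR 0 τ, hinner]
    simp [hR0, hasSum_zero]
  · intro hG0 t s a b
    have hR0 := HasLaurentSeries.eq_zero fun z => by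
      simpa only [hG0 z, Matrix.zero_apply, Pi.zero_apply] using hG a b z
    rw [← add_sub_cancel s t, hR]
    exact Complex.ofReal_eq_zero.1 (congrFun hR0 (t - s))

theorem norm_eq {G : Circle → Matrix κ κ ℂ} (h : HasCrossSpectrum y y G) (t : ℤ) (b : κ) :
    ‖y t b‖ = ‖y 0 b‖ := by
  obtain ⟨R, hR, -⟩ := h
  have hsq (s : ℤ) : ‖y s b‖ ^ 2 = R b b 0 := by
    rw [← real_inner_self_eq_norm_sq, ← hR s 0, add_zero]
  exact (sq_eq_sq₀ (norm_nonneg _) (norm_nonneg _)).1 ((hsq t).trans (hsq 0).symm)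

theorem hasPSD_iff {G : Circle → Matrix κ κ ℂ} (h : HasCrossSpectrum y y G)
    {Φ : ℂ → Matrix κ κ ℂ} : HasPSD y Φ ↔ ∀ z : Circle, Φ z = G z := by
  obtain ⟨R, hR, hG⟩ := h
  have hcorr (τ : ℤ) (a b : κ) : correlation y τ a b = R a b τ := by
    simpa [correlation] using hR 0 τ a b
  have hpsd (z : Circle) (a b : κ) :
      HasSum (fun τ => (correlation y τ a b : ℂ) * (z : ℂ) ^ (-τ)) (G z a b) := by
    simpa only [hcorr] using hG a b z
  constructor
  · exact fun hΦ z => Matrix.ext fun a b => (hΦ z z.norm_coe a b).unique (hpsd z a b)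
  · intro hΦ z hz a b
    have := hΦ ⟨z, mem_sphere_zero_iff_norm.2 hz⟩
    exact congrFun (congrFun this a) b ▸ hpsd ⟨z, mem_sphere_zero_iff_norm.2 hz⟩ a b

end HasCrossSpectrum

/-! ### Filters and orthogonality -/

theorem exists_isFiltered [Fintype κ] (P : Matrix ι κ TransferFunction) {y : VecProcess μ κ}
    (hy : ∀ t b, ‖y t b‖ = ‖y 0 b‖) : ∃ q, IsFiltered P y q := by
  choose p hp using fun a b => exists_isImpulseResponse (P a b)
  have hsummable (t : ℤ) (a : ι) : Summable fun k => ∑ b, p a b (t - k) • y k b := by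
    refine summable_sum fun b _ => Summable.of_norm ?_
    have hpab : Summable fun k => ‖p a b k‖ := by
      simpa only [Complex.norm_real] using (isImpulseResponse_iff.1 (hp a b)).summable_norm
    simpa only [norm_smul, hy _ b, Function.comp_def, Equiv.subLeft_apply] using
      ((Equiv.subLeft t).summable_iff.2 hpab).mul_right ‖y 0 b‖
  exact ⟨_, p, hp, fun t a => (hsummable t a).hasSum⟩

theorem exists_isImpulseResponse_single (n : ℤ) (r : ℝ) :
    ∃ f : TransferFunction, IsImpulseResponse f (Pi.single n r) := by
  obtain ⟨f, hf⟩ : ∃ f : TransferFunction, ∀ z : Circle, evalHom z f = r * (z : ℂ) ^ (-n) := by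
    obtain ⟨m, rfl | rfl⟩ := n.eq_nat_or_neg
    · exact ⟨ofDiv (Polynomial.C r) (Polynomial.X ^ m) fun z => by simp,
        fun z => by simp [evalHom_ofDiv, div_eq_mul_inv]⟩
    · exact ⟨ofDiv (Polynomial.C r * Polynomial.X ^ m) 1 fun z => by simp,
        fun z => by simp [evalHom_ofDiv]⟩
  have hcast (k : ℤ) : ((Pi.single n r : ℤ → ℝ) k : ℂ) = (Pi.single n (r : ℂ) : ℤ → ℂ) k :=
    (Pi.apply_single (fun _ => ((↑) : ℝ → ℂ)) (fun _ => Complex.ofReal_zero) n r k)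
  refine ⟨f, isImpulseResponse_iff.2 ?_⟩
  simpa only [hcast, hf] using HasLaurentSeries.monomial n (r : ℂ)

theorem exists_isFiltered_single [Fintype κ] [DecidableEq ι] (y : VecProcess μ κ) (n : ℤ) (r : ℝ)
    (a : ι) (b : κ) :
    ∃ P : Matrix ι κ TransferFunction, IsFiltered P y fun t => Pi.single a (r • y (t - n) b) := by
  classical
  obtain ⟨f, hf⟩ := exists_isImpulseResponse_single n r
  refine ⟨Matrix.single a b f, fun a' b' => if a = a' ∧ b = b' then Pi.single n r else 0,
    fun a' b' => ?_, fun t a' => ?_⟩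
  · by_cases hab : a = a' ∧ b = b'
    · simpa [hab] using hf
    · simp only [if_neg hab, Matrix.single_apply_of_ne _ _ _ _ _ hab, isImpulseResponse_iff]
      intro z
      simp [hasSum_zero]
  · by_cases ha : a = a'
    · subst ha
      have hsum := hasSum_single (f := fun k => (Pi.single n r : ℤ → ℝ) (t - k) • y k b) (t - n)
        fun k hk => by rw [Pi.single_eq_of_ne (by omega), zero_smul]
      simpa [ite_apply, ite_smul] using hsum
    · simp [ha, hasSum_zero]

namespace IsFiltered

variable [Fintype κ] {P P' : Matrix ι κ TransferFunction} {y : VecProcess μ κ}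
  {q q' : VecProcess μ ι}

theorem add (h : IsFiltered P y q) (h' : IsFiltered P' y q') :
    IsFiltered (P + P') y (q + q') := by
  obtain ⟨p, hp, hq⟩ := h
  obtain ⟨p', hp', hq'⟩ := h'
  refine ⟨fun a b k => p a b k + p' a b k, fun a b => isImpulseResponse_iff.2 ?_, fun t a => ?_⟩
  · simpa only [Matrix.add_apply, map_add, Complex.ofReal_add] using
      (isImpulseResponse_iff.1 (hp a b)).add (isImpulseResponse_iff.1 (hp' a b))
  · simpa only [add_smul, Finset.sum_add_distrib, Pi.add_apply] using (hq t a).add (hq' t a)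

theorem inner_eq_zero (h : IsFiltered P y q) {v : Lp ℝ 2 μ}
    (hv : ∀ s b, inner ℝ v (y s b) = 0) (t : ℤ) (a : ι) : inner ℝ v (q t a) = 0 := by
  obtain ⟨p, -, hq⟩ := h
  refine ((hq t a).mapL (innerSL ℝ v)).unique ?_
  simp [hv, hasSum_zero]

end IsFiltered

theorem inner_eq_zero_of_norm_le_norm_sub_smul {E : Type*} [NormedAddCommGroup E]
    [InnerProductSpace ℝ E] {v w : E} (h : ∀ r : ℝ, ‖v‖ ^ 2 ≤ ‖v - r • w‖ ^ 2) :
    inner ℝ v w = 0 := by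
  have hquad (r : ℝ) : 0 ≤ ‖w‖ ^ 2 * (r * r) + -2 * inner ℝ v w * r + 0 := by
    have hr := h r
    rw [norm_sub_sq_real, inner_smul_right, norm_smul, mul_pow, Real.norm_eq_abs, sq_abs] at hr
    linarith
  have hdiscrim := discrim_le_zero hquad
  rw [discrim, mul_zero, sub_zero] at hdiscrim
  have := pow_eq_zero_iff two_ne_zero |>.1 (le_antisymm hdiscrim (sq_nonneg _))
  linarith

section Orthogonality

variable [Fintype ι] [Fintype κ] {x xhat : VecProcess μ ι} {y : VecProcess μ κ}
  {W : Matrix ι κ TransferFunction}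

theorem inner_error_eq_zero_of_forall_le (hW : IsFiltered W y xhat)
    (hmin : ∀ (P : Matrix ι κ TransferFunction) (q : VecProcess μ ι), IsFiltered P y q →
      ∀ t, ∑ a, ‖x t a - xhat t a‖ ^ 2 ≤ ∑ a, ‖x t a - q t a‖ ^ 2) (t s : ℤ) (a : ι) (b : κ) :
    inner ℝ (x t a - xhat t a) (y s b) = 0 := by
  classical
  refine inner_eq_zero_of_norm_le_norm_sub_smul fun r => ?_
  obtain ⟨P, hP⟩ := exists_isFiltered_single (ι := ι) y (t - s) r a b
  have hle := hmin _ _ (hW.add hP) t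
  have hrest : ∑ a' ∈ {a}ᶜ, ‖x t a' - (xhat t + (Pi.single a (r • y s b) : ι → Lp ℝ 2 μ)) a'‖ ^ 2 =
      ∑ a' ∈ {a}ᶜ, ‖x t a' - xhat t a'‖ ^ 2 := by
    refine Finset.sum_congr rfl fun a' ha' => ?_
    rw [Pi.add_apply, Pi.single_eq_of_ne (by simpa using ha'), add_zero]
  simp only [Pi.add_apply, sub_sub_cancel] at hle hrest
  rw [Fintype.sum_eq_add_sum_compl a, Fintype.sum_eq_add_sum_compl a, hrest,
    add_le_add_iff_right, Pi.single_eq_same] at hle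
  rwa [sub_sub]

theorem sum_norm_sub_le_of_inner_error_eq_zero (hW : IsFiltered W y xhat) {t : ℤ}
    (h : ∀ s a b, inner ℝ (x t a - xhat t a) (y s b) = 0) {P : Matrix ι κ TransferFunction}
    {q : VecProcess μ ι} (hq : IsFiltered P y q) :
    ∑ a, ‖x t a - xhat t a‖ ^ 2 ≤ ∑ a, ‖x t a - q t a‖ ^ 2 := by
  refine Finset.sum_le_sum fun a _ => ?_
  have horth : inner ℝ (x t a - xhat t a) (xhat t a - q t a) = 0 := by
    rw [inner_sub_right, hW.inner_eq_zero (h · a), hq.inner_eq_zero (h · a), sub_zero]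
  rw [← sub_add_sub_cancel (x t a) (xhat t a) (q t a), norm_add_sq_real, horth, mul_zero,
    add_zero]
  exact le_add_of_nonneg_right (sq_nonneg _)

theorem isWienerFilter_iff {Gxy : Circle → Matrix ι κ ℂ} {Gyy : Circle → Matrix κ κ ℂ}
    (hxy : HasCrossSpectrum x y Gxy) (hyy : HasCrossSpectrum y y Gyy) :
    IsWienerFilter x y W ↔ ∀ z, Gxy z = W.map (evalHom z) * Gyy z := by
  constructor
  · rintro ⟨xhat, hW, hmin⟩ z
    exact sub_eq_zero.1 ((hxy.sub_left (hyy.filter_left hW)).inner_eq_zero_iff.1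
      (inner_error_eq_zero_of_forall_le hW hmin) z)
  · intro h
    obtain ⟨xhat, hW⟩ := exists_isFiltered W hyy.norm_eq
    have horth := (hxy.sub_left (hyy.filter_left hW)).inner_eq_zero_iff.2
      fun z => sub_eq_zero.2 (h z)
    exact ⟨xhat, hW, fun P q hq t =>
      sum_norm_sub_le_of_inner_error_eq_zero hW (fun s a b => horth t s a b) hq⟩

end Orthogonality

end Spectra

/-! ### The inverse spectrum -/

theorem toBlocks₁₂_eq_mul_toBlocks₂₂_iff {R ι κ : Type*} [CommRing R] [Fintype ι] [DecidableEq ι]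
    [Fintype κ] [DecidableEq κ] {K M : Matrix (ι ⊕ κ) (ι ⊕ κ) R} (hKM : K * M = 1)
    (hK : IsUnit K.toBlocks₁₁) (hM : IsUnit M.toBlocks₂₂) {W : Matrix ι κ R} :
    M.toBlocks₁₂ = W * M.toBlocks₂₂ ↔ K.toBlocks₁₁ * W = -K.toBlocks₁₂ := by
  have h₁₂ : K.toBlocks₁₁ * M.toBlocks₁₂ = -K.toBlocks₁₂ * M.toBlocks₂₂ := by
    have h := congrArg Matrix.toBlocks₁₂ hKM
    rw [← K.fromBlocks_toBlocks, ← M.fromBlocks_toBlocks, Matrix.fromBlocks_multiply,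
      ← Matrix.fromBlocks_one, Matrix.toBlocks_fromBlocks₁₂, Matrix.toBlocks_fromBlocks₁₂] at h
    rw [Matrix.neg_mul]
    exact eq_neg_of_add_eq_zero_left h
  let := hK.invertible
  let := hM.invertible
  rw [← Matrix.mul_right_inj_of_invertible K.toBlocks₁₁, h₁₂, ← Matrix.mul_assoc,
    Matrix.mul_left_inj_of_invertible, eq_comm]

section InverseSpectrum

variable {Ω : Type*} [MeasurableSpace Ω] {μ : Measure Ω} {n : Type*} [Fintype n] [DecidableEq n]
  {y : VecProcess μ n} {K : Matrix n n TransferFunction}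

/-- `y` has a positive definite spectral density, whose pointwise inverse on the unit circle is
the matrix of transfer functions `K`. -/
def IsInverseSpectrum (y : VecProcess μ n) (K : Matrix n n TransferFunction) : Prop :=
  ∃ Φ : Circle → Matrix n n ℂ, HasCrossSpectrum y y Φ ∧ (∀ z, (Φ z).PosDef) ∧
    ∀ z, K.map (evalHom z) * Φ z = 1

namespace IsInverseSpectrum

theorem posDef (h : IsInverseSpectrum y K) (z : Circle) : (K.map (evalHom z)).PosDef := by
  obtain ⟨Φ, -, hpos, hKΦ⟩ := h
  exact Matrix.inv_eq_left_inv (hKΦ z) ▸ (hpos z).inv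

theorem isUnit_submatrix {ι : Type*} [Fintype ι] [DecidableEq ι] (h : IsInverseSpectrum y K)
    {f : ι → n} (hf : f.Injective) : IsUnit (K.submatrix f f) :=
  isUnit_of_isUnit_map_evalHom fun z => ((h.posDef z).submatrix hf).isUnit

theorem isWienerFilter_iff {ι κ : Type*} [Fintype ι] [Fintype κ] (h : IsInverseSpectrum y K)
    (e : ι ⊕ κ ≃ n) {W : Matrix ι κ TransferFunction} :
    IsWienerFilter (fun t a => y t (e (.inl a))) (fun t b => y t (e (.inr b))) W ↔
      K.submatrix (e ∘ .inl) (e ∘ .inl) * W = -K.submatrix (e ∘ .inl) (e ∘ .inr) := by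
  classical
  have hKpos := h.posDef
  obtain ⟨Φ, hΦ, hpos, hKΦ⟩ := h
  have hinl : (e ∘ Sum.inl).Injective := e.injective.comp Sum.inl_injective
  have hinr : (e ∘ Sum.inr).Injective := e.injective.comp Sum.inr_injective
  have hnormal (z : Circle) :
      (Φ z).submatrix (e ∘ .inl) (e ∘ .inr) =
          W.map (evalHom z) * (Φ z).submatrix (e ∘ .inr) (e ∘ .inr) ↔
        (K.submatrix (e ∘ .inl) (e ∘ .inl) * W).map (evalHom z) =
          (-K.submatrix (e ∘ .inl) (e ∘ .inr)).map (evalHom z) := by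
    have hmul : (K.map (evalHom z)).submatrix e e * (Φ z).submatrix e e = 1 := by
      rw [Matrix.submatrix_mul_equiv, hKΦ, Matrix.submatrix_one_equiv]
    rw [Matrix.map_mul, Matrix.map_neg _ (map_neg (evalHom z))]
    exact toBlocks₁₂_eq_mul_toBlocks₂₂_iff hmul ((hKpos z).submatrix hinl).isUnit
      ((hpos z).submatrix hinr).isUnit
  refine (LDIM.isWienerFilter_iff (hΦ.submatrix (e ∘ .inl) (e ∘ .inr))
    (hΦ.submatrix (e ∘ .inr) (e ∘ .inr))).trans ?_
  exact ⟨fun hW => map_evalHom_injective fun z => (hnormal z).1 (hW z),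
    fun hW z => (hnormal z).2 (hW ▸ rfl)⟩

end IsInverseSpectrum

end InverseSpectrum

section Nodes

variable {V : Type*} {d : V → ℕ} {Ω : Type*} [MeasurableSpace Ω] {μ : Measure Ω}

theorem bijective_elim_coord {v : V} {S : Finset V} (hS : ∀ w, w ∈ S ↔ w ≠ v) :
    (Sum.elim (fun a => ⟨v, a⟩) fun b => ⟨b.1, b.2⟩ :
      Fin (d v) ⊕ SubCoord d S → Coord d).Bijective := by
  constructor
  · rintro (a | ⟨⟨w, hw⟩, a⟩) (b | ⟨⟨w', hw'⟩, b⟩) hab <;>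
      simp only [Sum.elim_inl, Sum.elim_inr, Sigma.mk.injEq] at hab
    · exact congrArg Sum.inl (eq_of_heq hab.2)
    · exact absurd hab.1.symm ((hS w').1 hw')
    · exact absurd hab.1 ((hS w).1 hw)
    · obtain ⟨rfl, hab⟩ := hab
      rw [eq_of_heq hab]
  · rintro ⟨w, a⟩
    obtain rfl | hw := eq_or_ne w v
    · exact ⟨.inl a, rfl⟩
    · exact ⟨.inr ⟨⟨w, (hS w).2 hw⟩, a⟩, rfl⟩

namespace IsInverseSpectrum

variable [Fintype V] [DecidableEq V] {y : VecProcess μ (Coord d)}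
  {K : Matrix (Coord d) (Coord d) TransferFunction} {v : V} {S : Finset V}

theorem isUnit_block (h : IsInverseSpectrum y K) (v : V) : IsUnit (block K v v) :=
  h.isUnit_submatrix sigma_mk_injective

theorem isWienerFilter_node_iff (h : IsInverseSpectrum y K) (hS : ∀ w, w ∈ S ↔ w ≠ v)
    {W : Matrix (Fin (d v)) (SubCoord d S) TransferFunction} :
    IsWienerFilter (nodeProcess y v) (subProcess y S) W ↔
      block K v v * W = -K.submatrix (fun a => ⟨v, a⟩) fun b => ⟨b.1, b.2⟩ :=
  h.isWienerFilter_iff (Equiv.ofBijective _ (bijective_elim_coord hS))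

theorem existsUnique_isWienerFilter (h : IsInverseSpectrum y K) (hS : ∀ w, w ∈ S ↔ w ≠ v) :
    ∃! W, IsWienerFilter (nodeProcess y v) (subProcess y S) W := by
  simp only [h.isWienerFilter_node_iff hS]
  let := (h.isUnit_block v).invertible
  exact ⟨⅟(block K v v) * -K.submatrix (fun a => ⟨v, a⟩) fun b => ⟨b.1, b.2⟩,
    Matrix.mul_invOf_cancel_left _ _, fun W hW => by rw [← hW, Matrix.invOf_mul_cancel_left]⟩

theorem block_mul_component (h : IsInverseSpectrum y K) (hS : ∀ w, w ∈ S ↔ w ≠ v)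
    {W : Matrix (Fin (d v)) (SubCoord d S) TransferFunction}
    (hW : IsWienerFilter (nodeProcess y v) (subProcess y S) W) {w : V} (hw : w ∈ S) :
    block K v v * component W w hw = -block K v w := by
  ext1 a b
  exact congrFun (congrFun ((h.isWienerFilter_node_iff hS).1 hW) a) ⟨⟨w, hw⟩, b⟩

end IsInverseSpectrum

end Nodes

/-! ### Blocks -/

section Blocks

variable {V : Type*} {d : V → ℕ} {A B : Matrix (Coord d) (Coord d) TransferFunction}

theorem block_sub (w v : V) : block (A - B) w v = block A w v - block B w v :=
  rfl

theorem block_conjTranspose (w v : V) : block Aᴴ w v = (block A v w)ᴴ :=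
  rfl

theorem block_mul [Fintype V] (w v : V) :
    block (A * B) w v = ∑ u, block A w u * block B u v := by
  ext1 a b
  simp only [block, Matrix.of_apply, Matrix.mul_apply, Matrix.sum_apply, Fintype.sum_sigma]

variable [DecidableEq V]

theorem block_blockDiagonal'_self
    (S : ∀ v, Matrix (Fin (d v)) (Fin (d v)) TransferFunction) (v : V) :
    block (Matrix.blockDiagonal' S) v v = S v :=
  Matrix.ext fun a b => Matrix.blockDiagonal'_apply_eq S v a b

theorem block_blockDiagonal'_of_ne
    (S : ∀ v, Matrix (Fin (d v)) (Fin (d v)) TransferFunction) {w v : V} (h : w ≠ v) :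
    block (Matrix.blockDiagonal' S) w v = 0 :=
  Matrix.ext fun a b => Matrix.blockDiagonal'_apply_ne S a b h

theorem block_one_self (v : V) :
    block (1 : Matrix (Coord d) (Coord d) TransferFunction) v v = 1 := by
  rw [← Matrix.blockDiagonal'_one, block_blockDiagonal'_self, Pi.one_apply]

theorem block_one_of_ne {w v : V} (h : w ≠ v) :
    block (1 : Matrix (Coord d) (Coord d) TransferFunction) w v = 0 := by
  rw [← Matrix.blockDiagonal'_one, block_blockDiagonal'_of_ne _ h]

theorem block_mul_blockDiagonal' [Fintype V]
    (S : ∀ v, Matrix (Fin (d v)) (Fin (d v)) TransferFunction) (w v : V) :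
    block (A * Matrix.blockDiagonal' S) w v = block A w v * S v := by
  rw [block_mul, Fintype.sum_eq_single v fun u hu => by
    rw [block_blockDiagonal'_of_ne S hu, Matrix.mul_zero], block_blockDiagonal'_self]

theorem eq_blockDiagonal'_block (h : ∀ a b : Coord d, a.1 ≠ b.1 → A a b = 0) :
    A = Matrix.blockDiagonal' fun v => block A v v := by
  ext1 ⟨v, a⟩ ⟨w, b⟩
  obtain rfl | hvw := eq_or_ne v w
  · rw [Matrix.blockDiagonal'_apply_eq, block, Matrix.of_apply]
  · rw [Matrix.blockDiagonal'_apply_ne _ _ _ hvw, h _ _ hvw]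

end Blocks

/-! ### The inverse spectrum of an influence model -/

theorem posDef_submatrix_mul_mul_conjTranspose {ι n : Type*} [Finite ι] [DecidableEq ι]
    [Fintype n] {A M : Matrix n n ℂ} (hM : M.PosDef) {f : ι → n} (hA : A.submatrix f f = 1) :
    ((A * M * Aᴴ).submatrix f f).PosDef := by
  cases nonempty_fintype ι
  have hleft : Function.LeftInverse (· ∘ f) (A.submatrix f id).vecMul := fun r => by
    change r ᵥ* A.submatrix f f = r
    rw [hA, Matrix.vecMul_one]
  exact hM.mul_mul_conjTranspose_same hleft.injective

section Model

variable {Ω : Type*} [MeasurableSpace Ω] {μ : Measure Ω}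

section Residual

variable {ι κ : Type*} [Fintype ι] [DecidableEq ι] {Q : Matrix ι ι TransferFunction}
  {e y : VecProcess μ ι}

theorem HasCrossSpectrum.residual {x : VecProcess μ κ} {G : Circle → Matrix ι κ ℂ}
    (h : HasCrossSpectrum y x G) (hQ : IsFiltered Q y (y - e)) :
    HasCrossSpectrum e x fun z => (1 - Q).map (evalHom z) * G z := by
  simpa [Matrix.map_sub, Matrix.sub_mul] using h.sub_left (h.filter_left hQ)

theorem HasCrossSpectrum.residual_residual {Φ : Circle → Matrix ι ι ℂ}
    (h : HasCrossSpectrum y y Φ) (hQ : IsFiltered Q y (y - e)) :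
    HasCrossSpectrum e e fun z =>
      (1 - Q).map (evalHom z) * Φ z * ((1 - Q).map (evalHom z))ᴴ := by
  simpa only [Matrix.conjTranspose_mul, Matrix.conjTranspose_conjTranspose] using
    ((h.residual hQ).symm.residual hQ).symm

end Residual

variable {V : Type*} [Fintype V] [DecidableEq V] {d : V → ℕ}
  {Q : Matrix (Coord d) (Coord d) TransferFunction} {e y : VecProcess μ (Coord d)}

theorem IsLDIM.exists_noise_spectrum (h : IsLDIM Q e y) :
    ∃ Θ : ∀ v, Matrix (Fin (d v)) (Fin (d v)) TransferFunction,
      HasPSD e fun z => (Matrix.blockDiagonal' Θ).map (evalAt · z) := by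
  obtain ⟨m, u, P, hu, huΦ, -, hPdiag, he⟩ := h.input
  have hdiag : P * Pᴴ = Matrix.blockDiagonal' fun v => block (P * Pᴴ) v v := by
    refine eq_blockDiagonal'_block fun a b hab => ?_
    rw [Matrix.mul_apply]
    refine Finset.sum_eq_zero fun c _ => ?_
    by_cases hac : a.1 = c.1
    · have hbc : b.1 ≠ c.1 := fun hbc => hab (hac.trans hbc.symm)
      rw [Matrix.conjTranspose_apply, hPdiag b c hbc, star_zero, mul_zero]
    · rw [hPdiag a c hac, zero_mul]
  have hspec := ((hu.hasCrossSpectrum huΦ).filter_left he).symm.filter_left he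
  refine ⟨fun v => block (P * Pᴴ) v v, hspec.hasPSD_iff.2 fun z => ?_⟩
  rw [← hdiag, Matrix.mul_one, ← map_evalHom_conjTranspose, ← Matrix.map_mul]
  rfl

variable {Θ : ∀ v, Matrix (Fin (d v)) (Fin (d v)) TransferFunction}

theorem isUnit_of_map_blockDiagonal'_eq {Φ : Circle → Matrix (Coord d) (Coord d) ℂ}
    (hpos : ∀ z, (Φ z).PosDef) (hloop : ∀ v, block Q v v = 0)
    (hΘ : ∀ z, (Matrix.blockDiagonal' Θ).map (evalHom z) =
      (1 - Q).map (evalHom z) * Φ z * ((1 - Q).map (evalHom z))ᴴ) (v : V) : IsUnit (Θ v) := by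
  refine isUnit_of_isUnit_map_evalHom fun z => ?_
  have hD : ((1 - Q).map (evalHom z)).submatrix (Sigma.mk v) (Sigma.mk v) = 1 := by
    change (block (1 - Q) v v).map (evalHom z) = 1
    rw [block_sub, hloop, sub_zero, block_one_self, Matrix.map_one _ (map_zero _) (map_one _)]
  rw [← block_blockDiagonal'_self Θ v]
  change IsUnit (((Matrix.blockDiagonal' Θ).map (evalHom z)).submatrix (Sigma.mk v) (Sigma.mk v))
  rw [hΘ]
  exact (posDef_submatrix_mul_mul_conjTranspose (hpos z) hD).isUnit

theorem exists_isInverseSpectrum {Φ : ℂ → Matrix (Coord d) (Coord d) ℂ} (hy : IsWSS y)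
    (hΦ : HasPSD y Φ) (hpos : ∀ z : ℂ, ‖z‖ = 1 → (Φ z).PosDef)
    (hQ : IsFiltered Q y (y - e)) (hloop : ∀ v, block Q v v = 0)
    (he : HasPSD e fun z => (Matrix.blockDiagonal' Θ).map (evalAt · z)) :
    ∃ S : ∀ v, Matrix (Fin (d v)) (Fin (d v)) TransferFunction, (∀ v, IsUnit (S v)) ∧
      IsInverseSpectrum y ((1 - Q)ᴴ * Matrix.blockDiagonal' S * (1 - Q)) := by
  have hspec := hy.hasCrossSpectrum hΦ
  have hposCircle (z : Circle) : (Φ z).PosDef := hpos z z.norm_coe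
  have hΘ (z : Circle) : (Matrix.blockDiagonal' Θ).map (evalHom z) =
      (1 - Q).map (evalHom z) * Φ z * ((1 - Q).map (evalHom z))ᴴ :=
    (hspec.residual_residual hQ).hasPSD_iff.1 he z
  choose S hS using fun v =>
    (isUnit_of_map_blockDiagonal'_eq hposCircle hloop hΘ v).exists_left_inv
  have hinv : Matrix.blockDiagonal' S * Matrix.blockDiagonal' Θ = 1 := by
    rw [← Matrix.blockDiagonal'_mul, funext hS]
    exact Matrix.blockDiagonal'_one
  refine ⟨S, fun v => IsUnit.of_mul_eq_one _ (hS v), fun z => Φ z, hspec, hposCircle, fun z => ?_⟩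
  have hone : (Matrix.blockDiagonal' S).map (evalHom z) *
      (1 - Q).map (evalHom z) * Φ z * ((1 - Q).map (evalHom z))ᴴ = 1 := by
    rw [Matrix.mul_assoc _ _ (Φ z), Matrix.mul_assoc, ← hΘ, ← Matrix.map_mul, hinv,
      Matrix.map_one _ (map_zero _) (map_one _)]
  rw [Matrix.map_mul, Matrix.map_mul, map_evalHom_conjTranspose]
  simpa only [Matrix.mul_assoc] using mul_eq_one_comm.1 hone

end Model

/-! ### Wiener filters at a node with a single child -/

section SingleChild

variable {V : Type*} [Fintype V] [DecidableEq V] {d : V → ℕ}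
  {Q : Matrix (Coord d) (Coord d) TransferFunction}
  {S : ∀ v, Matrix (Fin (d v)) (Fin (d v)) TransferFunction} {v n : V}

theorem block_conjTranspose_mul_blockDiagonal'_mul
    (D : Matrix (Coord d) (Coord d) TransferFunction) (v w : V) :
    block (Dᴴ * Matrix.blockDiagonal' S * D) v w =
      ∑ u, (block D u v)ᴴ * S u * block D u w := by
  simp only [block_mul (B := D), block_mul_blockDiagonal', block_conjTranspose]

theorem block_inverseSpectrum_of_singleChild (hvn : v ≠ n)
    (hchild : ∀ u, u ≠ n → block Q u v = 0) (w : V) :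
    block ((1 - Q)ᴴ * Matrix.blockDiagonal' S * (1 - Q)) v w =
      S v * block (1 - Q) v w - (block Q n v)ᴴ * S n * block (1 - Q) n w := by
  have hself : block (1 - Q) v v = 1 := by
    rw [block_sub, block_one_self, hchild v hvn, sub_zero]
  have hnext : block (1 - Q) n v = -block Q n v := by
    rw [block_sub, block_one_of_ne hvn.symm, zero_sub]
  rw [block_conjTranspose_mul_blockDiagonal'_mul, Fintype.sum_eq_add v n hvn, hself, hnext,
    Matrix.conjTranspose_one, Matrix.one_mul, Matrix.conjTranspose_neg, Matrix.neg_mul,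
    Matrix.neg_mul, ← sub_eq_add_neg]
  rintro u ⟨huv, hun⟩
  rw [block_sub, block_one_of_ne huv, hchild u hun, sub_zero, Matrix.conjTranspose_zero,
    Matrix.zero_mul, Matrix.zero_mul]

variable {Ω : Type*} [MeasurableSpace Ω] {μ : Measure Ω} {y : VecProcess μ (Coord d)}
  {T : Finset V} {W : Matrix (Fin (d v)) (SubCoord d T) TransferFunction}

theorem block_mul_one_sub_component_mul
    (hK : IsInverseSpectrum y ((1 - Q)ᴴ * Matrix.blockDiagonal' S * (1 - Q)))
    (hchild : ∀ u, u ≠ n → block Q u v = 0) (hQvn : block Q v n = 0) (hQnn : block Q n n = 0)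
    (hT : ∀ w, w ∈ T ↔ w ≠ v) (hW : IsWienerFilter (nodeProcess y v) (subProcess y T) W)
    (hn : n ∈ T) :
    block ((1 - Q)ᴴ * Matrix.blockDiagonal' S * (1 - Q)) v v *
      (1 - component W n hn * block Q n v) = S v := by
  have hvn : v ≠ n := ((hT n).1 hn).symm
  rw [Matrix.mul_sub, Matrix.mul_one, ← Matrix.mul_assoc, hK.block_mul_component hT hW,
    block_inverseSpectrum_of_singleChild hvn hchild,
    block_inverseSpectrum_of_singleChild hvn hchild]
  simp only [block_sub, block_one_self, block_one_of_ne hvn, block_one_of_ne hvn.symm, hQvn, hQnn,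
    hchild v hvn, sub_zero, zero_sub, Matrix.mul_zero, Matrix.mul_one, Matrix.mul_neg, neg_neg,
    sub_neg_eq_add, add_sub_cancel_right]

theorem IsGraphicalRepresentation.isUnit_and_mul_block_eq_component {G : Digraph V} {p : V}
    (hG : IsGraphicalRepresentation G Q) (hpn : p ≠ n) (hchild : ∀ u, G.Adj v u → u = n)
    (hGnv : ¬ G.Adj n v) (hGnn : ¬ G.Adj n n) (hGpn : ¬ G.Adj p n) (hS : IsUnit (S v))
    (hK : IsInverseSpectrum y ((1 - Q)ᴴ * Matrix.blockDiagonal' S * (1 - Q)))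
    (hT : ∀ w, w ∈ T ↔ w ≠ v) (hW : IsWienerFilter (nodeProcess y v) (subProcess y T) W)
    (hn : n ∈ T) (hp : p ∈ T) :
    IsUnit (1 - component W n hn * block Q n v) ∧
      (1 - component W n hn * block Q n v) * block Q v p = component W p hp := by
  have hpv : p ≠ v := (hT p).1 hp
  have hvn : v ≠ n := ((hT n).1 hn).symm
  have hQchild (u : V) (hu : u ≠ n) : block Q u v = 0 := hG v u (mt (hchild u) hu)
  have hKvv := hK.isUnit_block v
  have hfactor :=
    block_mul_one_sub_component_mul hK hQchild (hG n v hGnv) (hG n n hGnn) hT hW hn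
  have hparent : block ((1 - Q)ᴴ * Matrix.blockDiagonal' S * (1 - Q)) v v * component W p hp =
      S v * block Q v p := by
    rw [hK.block_mul_component hT hW, block_inverseSpectrum_of_singleChild hvn hQchild]
    simp only [block_sub, block_one_of_ne hpv.symm, block_one_of_ne hpn.symm, hG p n hGpn,
      sub_zero, zero_sub, Matrix.mul_zero, Matrix.mul_neg, neg_neg]
  let := hKvv.invertible
  refine ⟨hKvv.mul_left_iff.1 (hfactor ▸ hS), ?_⟩
  rw [← Matrix.mul_right_inj_of_invertible
    (block ((1 - Q)ᴴ * Matrix.blockDiagonal' S * (1 - Q)) v v), ← Matrix.mul_assoc, hfactor,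
    hparent]

end SingleChild

/-! ### Going round the loop -/

section RevolvingDoor

variable {F ι κ l : Type*} [CommRing F] [Fintype ι] [DecidableEq ι] [Fintype κ]

theorem isUnit_one_sub_mul_comm [DecidableEq κ] {A : Matrix ι κ F} {B : Matrix κ ι F} :
    IsUnit (1 - A * B) ↔ IsUnit (1 - B * A) := by
  rw [Matrix.isUnit_iff_isUnit_det, Matrix.det_one_sub_mul_comm, ← Matrix.isUnit_iff_isUnit_det]

variable [Fintype l] [DecidableEq l] {Qji Wji : Matrix κ ι F} {Qkj Wkj : Matrix l κ F}
  {Qik Wik : Matrix ι l F} {Wij : Matrix ι κ F} {Wjk : Matrix κ l F} {Wki : Matrix l ι F}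

theorem isUnit_and_mul_inv_mul_eq (hij : IsUnit (1 - Wij * Qji)) (hki : IsUnit (1 - Wki * Qik))
    (hik : (1 - Wij * Qji) * Qik = Wik) (hkj : (1 - Wki * Qik) * Qkj = Wkj) :
    IsUnit (1 - Wij * Qji - Wik * Wki) ∧
      (1 - Wij * Qji - Wik * Wki)⁻¹ * (Wik * Wkj) = Qik * Qkj := by
  have hfactor : 1 - Wij * Qji - Wik * Wki = (1 - Wij * Qji) * (1 - Qik * Wki) := by
    rw [← hik, Matrix.mul_sub, Matrix.mul_one, Matrix.mul_assoc]
  have hunit : IsUnit (1 - Wij * Qji - Wik * Wki) :=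
    hfactor ▸ hij.mul (isUnit_one_sub_mul_comm.1 hki)
  refine ⟨hunit, ?_⟩
  have hsolve : (1 - Wij * Qji - Wik * Wki) * (Qik * Qkj) = Wik * Wkj := by
    have hswap : (1 - Qik * Wki) * Qik = Qik * (1 - Wki * Qik) := by
      rw [Matrix.sub_mul, Matrix.mul_sub, Matrix.one_mul, Matrix.mul_one, Matrix.mul_assoc]
    calc (1 - Wij * Qji - Wik * Wki) * (Qik * Qkj)
        = (1 - Wij * Qji) * ((1 - Qik * Wki) * Qik) * Qkj := by
          rw [hfactor]; simp only [Matrix.mul_assoc]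
      _ = (1 - Wij * Qji) * Qik * ((1 - Wki * Qik) * Qkj) := by
          rw [hswap]; simp only [Matrix.mul_assoc]
      _ = Wik * Wkj := by rw [hik, hkj]
  rw [← hsolve, Matrix.nonsing_inv_mul_cancel_left _ _
    ((Matrix.isUnit_iff_isUnit_det _).1 hunit)]

theorem revolving_door [DecidableEq κ] (hij : IsUnit (1 - Wij * Qji)) (hki : IsUnit (1 - Wki * Qik))
    (hjk : IsUnit (1 - Wjk * Qkj)) (hik : (1 - Wij * Qji) * Qik = Wik)
    (hkj : (1 - Wki * Qik) * Qkj = Wkj) (hji : (1 - Wjk * Qkj) * Qji = Wji) :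
    let A := 1 - Wij * Qji - Wik * Wki
    let B := 1 - Wjk * Wkj - Wjk * Wki * A⁻¹ * (Wik * Wkj)
    IsUnit A ∧ IsUnit B ∧ Qji = B⁻¹ * Wji := by
  intro A B
  obtain ⟨hA, hAinv⟩ := isUnit_and_mul_inv_mul_eq hij hki hik hkj
  have hB : B = 1 - Wjk * Qkj := by
    calc B = 1 - Wjk * (Wkj + Wki * (A⁻¹ * (Wik * Wkj))) := by
          simp only [B, Matrix.mul_add, Matrix.mul_assoc, sub_sub]
      _ = 1 - Wjk * Qkj := by
          rw [hAinv, ← hkj, Matrix.sub_mul, Matrix.one_mul, Matrix.mul_assoc, sub_add_cancel]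
  rw [hB]
  refine ⟨hA, hjk, ?_⟩
  rw [← hji, Matrix.nonsing_inv_mul_cancel_left _ _ ((Matrix.isUnit_iff_isUnit_det _).1 hjk)]

end RevolvingDoor

instance : DecidableRel loopGraph.Adj := fun v w =>
  decidable_of_iff ((v, w) ∈ ({(.i, .j), (.j, .k), (.k, .i), (.s, .i), (.s, .j), (.s, .k)} :
    Finset (Node × Node))) (by simp [loopGraph])

end LDIM

end

open LDIM in
theorem mainTheorem5_general {Ω : Type*} [MeasurableSpace Ω] (μ : Measure Ω) (d : Node → ℕ)
    (Q : Matrix (Coord d) (Coord d) TransferFunction) (e y : VecProcess μ (Coord d))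
    (hy : IsWSS y) (hQ : IsFiltered Q y (y - e))
    (Θ : ∀ v, Matrix (Fin (d v)) (Fin (d v)) TransferFunction)
    (hΘ : HasPSD e fun z => (Matrix.blockDiagonal' Θ).map (evalAt · z))
    (hG : IsGraphicalRepresentation loopGraph Q)
    (Φ : ℂ → Matrix (Coord d) (Coord d) ℂ) (hΦ : HasPSD y Φ)
    (hpos : ∀ z : ℂ, ‖z‖ = 1 → (Φ z).PosDef) :
    (∃! W, IsWienerFilter (nodeProcess y .j) (subProcess y {.i, .k, .s}) W) ∧
    (∃! W, IsWienerFilter (nodeProcess y .k) (subProcess y {.j, .i, .s}) W) ∧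
    (∃! W, IsWienerFilter (nodeProcess y .i) (subProcess y {.k, .j, .s}) W) ∧
    ∀ (Wj : Matrix (Fin (d .j)) (SubCoord d {.i, .k, .s}) TransferFunction)
      (Wk : Matrix (Fin (d .k)) (SubCoord d {.j, .i, .s}) TransferFunction)
      (Wi : Matrix (Fin (d .i)) (SubCoord d {.k, .j, .s}) TransferFunction),
      IsWienerFilter (nodeProcess y .j) (subProcess y {.i, .k, .s}) Wj →
      IsWienerFilter (nodeProcess y .k) (subProcess y {.j, .i, .s}) Wk →
      IsWienerFilter (nodeProcess y .i) (subProcess y {.k, .j, .s}) Wi →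
      let Wji := component Wj .i (by decide)
      let Wjk := component Wj .k (by decide)
      let Wkj := component Wk .j (by decide)
      let Wki := component Wk .i (by decide)
      let Wik := component Wi .k (by decide)
      let Wij := component Wi .j (by decide)
      let A := 1 - Wij * block Q .j .i - Wik * Wki
      let B := 1 - Wjk * Wkj - Wjk * Wki * A⁻¹ * (Wik * Wkj)
      IsUnit A ∧ IsUnit B ∧ block Q .j .i = B⁻¹ * Wji := by
  have hloop : ∀ v, ¬ loopGraph.Adj v v := by decide
  obtain ⟨S, hS, hK⟩ := exists_isInverseSpectrum hy hΦ hpos hQ (fun v => hG v v (hloop v)) hΘ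
  have hTj : ∀ w, w ∈ ({.i, .k, .s} : Finset Node) ↔ w ≠ .j := by decide
  have hTk : ∀ w, w ∈ ({.j, .i, .s} : Finset Node) ↔ w ≠ .k := by decide
  have hTi : ∀ w, w ∈ ({.k, .j, .s} : Finset Node) ↔ w ≠ .i := by decide
  refine ⟨hK.existsUnique_isWienerFilter hTj, hK.existsUnique_isWienerFilter hTk,
    hK.existsUnique_isWienerFilter hTi, fun Wj Wk Wi hWj hWk hWi => ?_⟩
  obtain ⟨hjk, hji⟩ := hG.isUnit_and_mul_block_eq_component (n := .k) (p := .i) (by decide)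
    (by decide) (by decide) (hloop _) (by decide) (hS .j) hK hTj hWj (by decide) (by decide)
  obtain ⟨hki, hkj⟩ := hG.isUnit_and_mul_block_eq_component (n := .i) (p := .j) (by decide)
    (by decide) (by decide) (hloop _) (by decide) (hS .k) hK hTk hWk (by decide) (by decide)
  obtain ⟨hij, hik⟩ := hG.isUnit_and_mul_block_eq_component (n := .j) (p := .k) (by decide)
    (by decide) (by decide) (hloop _) (by decide) (hS .i) hK hTi hWi (by decide) (by decide)
  exact revolving_door hij hki hjk hik hkj hji

open LDIM in
theorem mainTheorem5 {Ω : Type*} [MeasurableSpace Ω] (μ : Measure Ω) [IsProbabilityMeasure μ]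
    (d : Node → ℕ)
    (Q : Matrix (Coord d) (Coord d) TransferFunction)
    (e y : VecProcess μ (Coord d))
    (hLDIM : IsLDIM Q e y)
    (hG : IsGraphicalRepresentation loopGraph Q)
    (Φ : ℂ → Matrix (Coord d) (Coord d) ℂ)
    (hΦ : HasPSD y Φ)
    (hpos : ∀ z : ℂ, ‖z‖ = 1 → (Φ z).PosDef) :
    -- the three Wiener filters exist and are unique
    (∃! W, IsWienerFilter (nodeProcess y .j) (subProcess y {.i, .k, .s}) W) ∧
    (∃! W, IsWienerFilter (nodeProcess y .k) (subProcess y {.j, .i, .s}) W) ∧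
    (∃! W, IsWienerFilter (nodeProcess y .i) (subProcess y {.k, .j, .s}) W) ∧
    ∀ (Wj : Matrix (Fin (d .j)) (SubCoord d {.i, .k, .s}) TransferFunction)
      (Wk : Matrix (Fin (d .k)) (SubCoord d {.j, .i, .s}) TransferFunction)
      (Wi : Matrix (Fin (d .i)) (SubCoord d {.k, .j, .s}) TransferFunction),
      IsWienerFilter (nodeProcess y .j) (subProcess y {.i, .k, .s}) Wj →
      IsWienerFilter (nodeProcess y .k) (subProcess y {.j, .i, .s}) Wk →
      IsWienerFilter (nodeProcess y .i) (subProcess y {.k, .j, .s}) Wi →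
      let Wji := component Wj .i (by decide)
      let Wjk := component Wj .k (by decide)
      let Wkj := component Wk .j (by decide)
      let Wki := component Wk .i (by decide)
      let Wik := component Wi .k (by decide)
      let Wij := component Wi .j (by decide)
      let A := 1 - Wij * block Q .j .i - Wik * Wki
      let B := 1 - Wjk * Wkj - Wjk * Wki * A⁻¹ * (Wik * Wkj)
      -- both inverses exist as matrices of transfer functions without poles on the unit circle
      IsUnit A ∧ IsUnit B ∧ block Q .j .i = B⁻¹ * Wji := by
  obtain ⟨Θ, hΘ⟩ := hLDIM.exists_noise_spectrum
  exact mainTheorem5_general μ d Q e y hLDIM.wss hLDIM.dynamics Θ hΘ hG Φ hΦ hpos
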